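/- Let $\xi_1,\dots,\xi_n$ be independent Bernoulli random variables with $P(\xi_i=1)=1-P(\xi_i=0)=p_i\in[0,1]$, and put $W=\xi_1+\dots+\xi_n$, $\lambda=\sum_{i=1}^n p_i$, $\lambda_2=\sum_{i=1}^n p_i^2$. Let $\mathcal L(W)$ be the distribution of $W$ and $\Pi$ the Poisson distribution with parameter $\lambda$. For a signed measure $M$ on the nonnegative integers let $M(j)=\sum_{k=0}^{j}M\{k\}$, and let $\|M\|_W=\sum_{j=0}^\infty|M(j)|$ be its Wasserstein norm. (a) There is an absolute constant $C>0$ such that, whenever $\max_i p_i\le 1/20$ and $\lambda\ge 1$, the norm $\|\mathcal L(W)-\Pi\|_W$ is finite and $$\Bigl|\,\|\mathcal L(W)-\Pi\|_W-\frac{\lambda_2}{\sqrt{2\pi\lambda}}\Bigr|\le \frac{C\lambda_2}{\sqrt{\lambda}}\Bigl(\max_j p_j+\frac1{\sqrt\lambda}\Bigr).$$ (b) Consider a sequence of such sums: for each $n$, let $W_n$ be a sum of finitely many independent Bernoulli variables with success probabilities $p_{n,1},\dots,p_{n,N_n}$, and let $\lambda^{(n)}=\sum_i p_{n,i}$, $\lambda_2^{(n)}=\sum_i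 p_{n,i}^2$, with $\Pi^{(n)}$ the Poisson distribution with parameter $\lambda^{(n)}$. If $\max_i p_{n,i}\to0$ and $\lambda^{(n)}\to\infty$ as $n\to\infty$, then all the norms $\|\mathcal L(W_n)-\Pi^{(n)}\|_W$ are finite and $$\lim_{n\to\infty}\frac{\sqrt{\lambda^{(n)}}}{\lambda_2^{(n)}}\,\bigl\|\mathcal L(W_n)-\Pi^{(n)}\bigr\|_W=\frac1{\sqrt{2\pi}}.$$ Moreover, $1/\sqrt{2\pi}\le 0.399$. -/

import Mathlib

open MeasureTheory ProbabilityTheory Filter Topology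

/-- The value `M(x) = ∑_{k=0}^x M{k}` at `x` of the distribution function of a signed measure `M`
on the nonnegative integers. -/
noncomputable def signedCDF (M : SignedMeasure ℕ) (x : ℕ) : ℝ :=
  ∑ k ∈ Finset.range (x + 1), M {k}

/-- The Wasserstein norm of `M` is finite, that is, `∑_j |M(j)| < ∞`. -/
def FiniteWassersteinNorm (M : SignedMeasure ℕ) : Prop :=
  Summable fun j : ℕ => |signedCDF M j|

/-- The Wasserstein norm `‖M‖_W = ∑_{j=0}^∞ |M(j)|` of a signed measure on the nonnegative integers
(meaningful if `FiniteWassersteinNorm M`). -/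
noncomputable def wassersteinNorm (M : SignedMeasure ℕ) : ℝ :=
  ∑' j : ℕ, |signedCDF M j|

/-- `ξ` is a finite family of independent random variables on `(Ω, P)`, and `ξ i` is Bernoulli with
`P(ξ i = 1) = p i` and `P(ξ i = 0) = 1 - p i`. -/
structure IsIndepBernoulli {Ω : Type*} [MeasurableSpace Ω] (P : Measure Ω) {n : ℕ}
    (p : Fin n → unitInterval) (ξ : Fin n → Ω → ℕ) : Prop where
  indep : iIndepFun ξ P
  law : ∀ i, HasLaw (ξ i) (bernoulliMeasure (1 : ℕ) 0 (p i)) P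

/-- `λ = ∑ p_i`. -/
noncomputable def lam {n : ℕ} (p : Fin n → unitInterval) : ℝ := ∑ i, (p i : ℝ)

/-- `λ₂ = ∑ p_i²`. -/
noncomputable def lamTwo {n : ℕ} (p : Fin n → unitInterval) : ℝ := ∑ i, (p i : ℝ) ^ 2

/-- `max p_i` (and `0` for the empty family). -/
noncomputable def maxProb {n : ℕ} (p : Fin n → unitInterval) : ℝ := ⨆ i, (p i : ℝ)

/-- The signed measure `L(W) - Π`, where `W = ∑ ξ_i` and `Π` is the Poisson distribution
with parameter `λ = ∑ p_i`. -/
noncomputable def poissonError {Ω : Type*} [MeasurableSpace Ω] (P : Measure Ω)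
    [IsProbabilityMeasure P] {n : ℕ} (p : Fin n → unitInterval) (ξ : Fin n → Ω → ℕ) :
    SignedMeasure ℕ :=
  (P.map fun ω => ∑ i, ξ i ω).toSignedMeasure
    - (poissonMeasure (Real.toNNReal (lam p))).toSignedMeasure

/-!
With `z = X - 1`, the generating function of `L(W) - Π` is `∏ (1 + p_i z) - exp (λ z)`, which is
`z * Q`; since division by `X - 1` is (minus) summation of coefficients, `‖L(W) - Π‖_W` is the norm
of `Q` in the Wiener algebra. Thinning gives a path `τ ↦ H_τ` from `exp (λ z)` to `∏ (1 + p_i z)`: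
a product of the Bernoulli factors `1 + τ p_i z` with the Poisson factors of the remaining
intensity. The derivative of `H_τ` is `-τ z² ∑ p_i² H_τ^(i)`, where `H^(i)` omits the `i`-th factor,
so `Q` is the integral of `-τ z ∑ p_i² H_τ^(i)`. As long as an intensity `(1 - τ) λ` is left, the
smoothing estimate `‖z ^ k * exp (t z)‖ ≤ √(k / t) ^ k` shows that replacing `H_τ^(i)` by
`exp (λ z)` costs little, whence `Q ≈ -(λ₂ / 2) z exp (λ z)`. Finally `‖z exp (λ z)‖` is twice the
largest Poisson weight, which is `1 / √(2πλ)` to first order by Stirling's formula.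
-/

/-- The Poisson weight `e^{-t} t^k / k!`, with a real parameter `t`. -/
noncomputable def poissonWeight (t : ℝ) (k : ℕ) : ℝ :=
  Real.exp (-t) * t ^ k / k.factorial

section PoissonWeight

variable {t : ℝ}

theorem poissonWeight_nonneg (ht : 0 ≤ t) (k : ℕ) : 0 ≤ poissonWeight t k := by
  unfold poissonWeight
  positivity

theorem succ_mul_poissonWeight_succ (t : ℝ) (k : ℕ) :
    ((k + 1 : ℕ) : ℝ) * poissonWeight t (k + 1) = t * poissonWeight t k := by
  rw [poissonWeight, poissonWeight, Nat.factorial_succ]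
  push_cast
  field_simp
  ring

theorem hasSum_poissonWeight (t : ℝ) : HasSum (poissonWeight t) 1 := by
  have h := (NormedSpace.expSeries_div_hasSum_exp t).mul_left (Real.exp (-t))
  rw [← Real.exp_eq_exp_ℝ, ← Real.exp_add, neg_add_cancel, Real.exp_zero] at h
  convert! h using 2 with k
  rw [poissonWeight, mul_div_assoc]

theorem hasSum_nat_mul_poissonWeight (t : ℝ) :
    HasSum (fun k : ℕ => (k : ℝ) * poissonWeight t k) t := by
  rw [← hasSum_nat_add_iff' 1]
  simp only [succ_mul_poissonWeight_succ]
  simpa using (hasSum_poissonWeight t).mul_left t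

theorem hasSum_sq_mul_poissonWeight (t : ℝ) :
    HasSum (fun k : ℕ => (k : ℝ) ^ 2 * poissonWeight t k) (t ^ 2 + t) := by
  rw [← hasSum_nat_add_iff' 1]
  convert! ((hasSum_nat_mul_poissonWeight t).add (hasSum_poissonWeight t)).mul_left t using 1
  · ext k
    rw [pow_two, mul_assoc, succ_mul_poissonWeight_succ]
    push_cast
    ring
  · simp
    ring

theorem hasSum_div_sub_one_mul_poissonWeight (ht : t ≠ 0) :
    HasSum (fun k : ℕ => (k / t - 1) * poissonWeight t k) 0 := by
  convert! ((hasSum_nat_mul_poissonWeight t).mul_left (1 / t)).sub (hasSum_poissonWeight t) using 1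
  · ext k
    ring
  · field_simp
    ring

theorem hasSum_div_sub_one_sq_mul_poissonWeight (ht : t ≠ 0) :
    HasSum (fun k : ℕ => (k / t - 1) ^ 2 * poissonWeight t k) (1 / t) := by
  convert! (((hasSum_sq_mul_poissonWeight t).mul_left (1 / t ^ 2)).sub
    ((hasSum_nat_mul_poissonWeight t).mul_left (2 / t))).add (hasSum_poissonWeight t) using 1
  · ext k
    ring
  · field_simp
    ring

theorem sum_range_one_sub_div_mul_poissonWeight (ht : t ≠ 0) (n : ℕ) :
    ∑ k ∈ Finset.range (n + 1), (1 - k / t) * poissonWeight t k = poissonWeight t n := by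
  induction n with
  | zero => simp
  | succ n ih =>
    rw [Finset.sum_range_succ, ih, sub_mul, div_mul_eq_mul_div, succ_mul_poissonWeight_succ]
    field_simp
    ring

/-- Since the mean is `0`, the mean absolute deviation is twice the (telescoping) sum of the
deviations of the `k ≤ t`. -/
theorem hasSum_abs_div_sub_one_mul_poissonWeight (ht : 0 < t) :
    HasSum (fun k : ℕ => |(k / t - 1) * poissonWeight t k|) (2 * poissonWeight t ⌊t⌋₊) := by
  let below (k : ℕ) : ℝ :=
    if k ∈ Finset.range (⌊t⌋₊ + 1) then (1 - k / t) * poissonWeight t k else 0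
  have hbelow : HasSum below (poissonWeight t ⌊t⌋₊) := by
    rw [← sum_range_one_sub_div_mul_poissonWeight ht.ne',
      ← Finset.sum_congr rfl fun k hk => if_pos (c := k ∈ Finset.range (⌊t⌋₊ + 1)) hk]
    exact hasSum_sum_of_ne_finset_zero fun k hk => if_neg hk
  convert! (hasSum_div_sub_one_mul_poissonWeight ht.ne').add (hbelow.mul_left 2) using 1
  · ext k
    have hw := poissonWeight_nonneg ht.le k
    rw [abs_mul, abs_of_nonneg hw]
    simp only [below, Finset.mem_range, Nat.lt_succ_iff, Nat.le_floor_iff ht.le]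
    split_ifs with hk
    · rw [abs_of_nonpos (sub_nonpos.2 ((div_le_one ht).2 hk))]
      ring
    · rw [abs_of_nonneg (sub_nonneg.2 ((one_le_div ht).2 (not_le.1 hk).le))]
      ring
  · rw [zero_add]

theorem two_mul_poissonWeight_floor_le (ht : 0 < t) :
    2 * poissonWeight t ⌊t⌋₊ ≤ 1 / √t := by
  have hsq : √t ^ 2 = t := Real.sq_sqrt ht.le
  have : 0 < √t := Real.sqrt_pos.2 ht
  have hmean := ((hasSum_div_sub_one_sq_mul_poissonWeight ht.ne').mul_left (√t / 2)).add
    ((hasSum_poissonWeight t).mul_left (1 / (2 * √t)))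
  have hval : √t / 2 * (1 / t) + 1 / (2 * √t) * 1 = 1 / √t := by
    field_simp
    linarith
  rw [hval] at hmean
  refine hasSum_le (fun k => ?_) (hasSum_abs_div_sub_one_mul_poissonWeight ht) hmean
  have amgm (x : ℝ) : |x| ≤ √t / 2 * x ^ 2 + 1 / (2 * √t) := by
    have h : √t / 2 * x ^ 2 + 1 / (2 * √t) - |x| = (√t * |x| - 1) ^ 2 / (2 * √t) := by
      rw [← sq_abs x]
      field_simp
      ring
    rw [← sub_nonneg, h]
    positivity
  rw [abs_mul, abs_of_nonneg (poissonWeight_nonneg ht.le k), ← mul_assoc, ← add_mul]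
  exact mul_le_mul_of_nonneg_right (amgm _) (poissonWeight_nonneg ht.le k)

end PoissonWeight

section Smoothing

variable {A : Type*} [NormedCommRing A] [NormedAlgebra ℝ A] [CompleteSpace A]

theorem exp_natCast_mul_smul (n : ℕ) (t : ℝ) (x : A) :
    NormedSpace.exp ((n * t) • x) = NormedSpace.exp (t • x) ^ n := by
  let _ : NormedAlgebra ℚ A := NormedAlgebra.restrictScalars ℚ ℝ A
  rw [mul_smul, Nat.cast_smul_eq_nsmul, NormedSpace.exp_nsmul]

theorem hasSum_poissonWeight_smul_pow (t : ℝ) (x : A) :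
    HasSum (fun k : ℕ => poissonWeight t k • x ^ k) (NormedSpace.exp (t • (x - 1))) := by
  have hexp : NormedSpace.exp (t • (x - 1)) = Real.exp (-t) • NormedSpace.exp (t • x) := by
    let _ : NormedAlgebra ℚ A := NormedAlgebra.restrictScalars ℚ ℝ A
    rw [smul_sub, sub_eq_add_neg, ← neg_smul, NormedSpace.exp_add, mul_comm,
      ← Algebra.algebraMap_eq_smul_one, ← NormedSpace.algebraMap_exp_comm, ← Real.exp_eq_exp_ℝ,
      ← Algebra.smul_def]
  rw [hexp]
  convert! (NormedSpace.exp_series_hasSum_exp' (𝕂 := ℝ) (t • x)).const_smul (Real.exp (-t))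
    using 2 with k
  rw [smul_pow, smul_smul, smul_smul, poissonWeight]
  ring_nf

theorem hasSum_sub_one_mul_exp {t : ℝ} (ht : t ≠ 0) (x : A) :
    HasSum (fun k : ℕ => ((k / t - 1) * poissonWeight t k) • x ^ k)
      ((x - 1) * NormedSpace.exp (t • (x - 1))) := by
  have hexp := hasSum_poissonWeight_smul_pow t x
  have hmul : HasSum (fun k : ℕ => (k / t * poissonWeight t k) • x ^ k)
      (x * NormedSpace.exp (t • (x - 1))) := by
    rw [← hasSum_nat_add_iff' 1]
    convert! hexp.mul_left x using 1
    · ext k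
      rw [div_mul_eq_mul_div, succ_mul_poissonWeight_succ, mul_div_cancel_left₀ _ ht,
        mul_smul_comm, pow_succ']
    · simp
  simpa only [sub_mul, one_mul, sub_smul] using hmul.sub hexp

variable [NormOneClass A] {x : A} {t : ℝ}

theorem norm_sub_one_mul_exp_le (ht : 0 < t) (hx : ‖x‖ ≤ 1) :
    ‖(x - 1) * NormedSpace.exp (t • (x - 1))‖ ≤ 1 / √t := by
  rw [← (hasSum_sub_one_mul_exp ht.ne' x).tsum_eq]
  refine (tsum_of_norm_bounded (hasSum_abs_div_sub_one_mul_poissonWeight ht) fun k => ?_).trans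
    (two_mul_poissonWeight_floor_le ht)
  rw [norm_smul, Real.norm_eq_abs]
  exact mul_le_of_le_one_right (abs_nonneg _)
    ((norm_pow_le x k).trans (pow_le_one₀ (norm_nonneg x) hx))

/-- Each of the `n` factors `x - 1` is smoothed by one factor `exp ((t / n) • (x - 1))`. -/
theorem norm_sub_one_pow_mul_exp_le (ht : 0 < t) (hx : ‖x‖ ≤ 1) {n : ℕ} (hn : n ≠ 0) :
    ‖(x - 1) ^ n * NormedSpace.exp (t • (x - 1))‖ ≤ √(n / t) ^ n := by
  have hn' : (0 : ℝ) < n := by positivity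
  calc ‖(x - 1) ^ n * NormedSpace.exp (t • (x - 1))‖
      = ‖((x - 1) * NormedSpace.exp ((t / n) • (x - 1))) ^ n‖ := by
        rw [mul_pow, ← exp_natCast_mul_smul, mul_div_cancel₀ _ hn'.ne']
    _ ≤ (1 / √(t / n)) ^ n := (norm_pow_le _ n).trans
        (pow_le_pow_left₀ (norm_nonneg _) (norm_sub_one_mul_exp_le (div_pos ht hn') hx) n)
    _ = √(n / t) ^ n := by rw [one_div, ← Real.sqrt_inv, inv_div]

end Smoothing

section Interpolation

variable {A ι : Type*} [NormedCommRing A] [NormedAlgebra ℝ A]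

/-- The path from `exp (t • z)` at `τ = 0` to `∏ i ∈ s, (1 + p i • z)` at `τ = 1`. If `z = X - 1`,
its value at `τ` is the generating function of a sum of independent Bernoulli variables with
parameters `τ * p i` and a Poisson variable with mean `(1 - τ) * t`. -/
noncomputable def poissonPath (s : Finset ι) (p : ι → ℝ) (t : ℝ) (z : A) (τ : ℝ) : A :=
  (∏ i ∈ s, (1 + (τ * p i) • z)) * NormedSpace.exp (((1 - τ) * t) • z)

theorem poissonPath_zero (s : Finset ι) (p : ι → ℝ) (t : ℝ) (z : A) :
    poissonPath s p t z 0 = NormedSpace.exp (t • z) := by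
  simp [poissonPath]

theorem poissonPath_one (s : Finset ι) (p : ι → ℝ) (t : ℝ) (z : A) :
    poissonPath s p t z 1 = ∏ i ∈ s, (1 + p i • z) := by
  simp [poissonPath]

theorem continuous_poissonPath [CompleteSpace A] (s : Finset ι) (p : ι → ℝ) (t : ℝ) (z : A) :
    Continuous (poissonPath s p t z) := by
  let _ : NormedAlgebra ℚ A := NormedAlgebra.restrictScalars ℚ ℝ A
  have := NormedSpace.exp_continuous (𝔸 := A)
  unfold poissonPath
  fun_prop

variable [DecidableEq ι]

theorem smul_poissonPath_erase {s : Finset ι} {i : ι} (hi : i ∈ s) (p : ι → ℝ) (t : ℝ) (z : A)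
    (τ : ℝ) : p i • poissonPath (s.erase i) p t z τ =
      p i • poissonPath s p t z τ - (τ * p i ^ 2) • (z * poissonPath (s.erase i) p t z τ) := by
  rw [poissonPath, poissonPath, ← Finset.mul_prod_erase s _ hi]
  simp only [Algebra.smul_def, map_mul, map_pow]
  ring

variable [CompleteSpace A]

theorem hasDerivAt_poissonPath (s : Finset ι) (p : ι → ℝ) (t : ℝ) (z : A) (τ : ℝ) :
    HasDerivAt (poissonPath s p t z)
      (((∑ i ∈ s, p i) - t) • (z * poissonPath s p t z τ)
        - τ • (z ^ 2 * ∑ i ∈ s, p i ^ 2 • poissonPath (s.erase i) p t z τ)) τ := by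
  have hprod : HasDerivAt (fun τ : ℝ => ∏ i ∈ s, (1 + (τ * p i) • z))
      (∑ i ∈ s, (∏ j ∈ s.erase i, (1 + (τ * p j) • z)) • p i • z) τ :=
    HasDerivAt.fun_finsetProd fun i _ => by
      simpa using (((hasDerivAt_id τ).mul_const (p i)).smul_const z).const_add 1
  have hexp : HasDerivAt (fun τ : ℝ => NormedSpace.exp (((1 - τ) * t) • z))
      ((-t) • (z * NormedSpace.exp (((1 - τ) * t) • z))) τ := by
    refine ((hasDerivAt_exp_smul_const' (𝕂 := ℝ) z ((1 - τ) * t)).scomp τ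
      (((hasDerivAt_id τ).const_sub 1).mul_const t)).congr_deriv ?_
    rw [neg_one_mul]
  refine (hprod.mul hexp).congr_deriv ?_
  calc (∑ i ∈ s, (∏ j ∈ s.erase i, (1 + (τ * p j) • z)) • p i • z)
          * NormedSpace.exp (((1 - τ) * t) • z)
        + (∏ i ∈ s, (1 + (τ * p i) • z)) * (-t) • (z * NormedSpace.exp (((1 - τ) * t) • z))
      = z * ∑ i ∈ s, p i • poissonPath (s.erase i) p t z τ - t • (z * poissonPath s p t z τ) := by
        simp only [poissonPath, Finset.sum_mul, Finset.mul_sum, neg_smul, mul_neg, smul_eq_mul,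
          ← sub_eq_add_neg, mul_smul_comm, smul_mul_assoc]
        congr 1
        · exact Finset.sum_congr rfl fun i _ => by ring_nf
        · ring_nf
    _ = _ := by
        rw [Finset.sum_congr rfl fun i hi => smul_poissonPath_erase hi p t z τ,
          Finset.sum_sub_distrib, ← Finset.sum_smul]
        simp only [sub_smul, mul_sub, Finset.mul_sum, Finset.smul_sum, mul_smul, mul_smul_comm,
          pow_two, mul_assoc]
        abel

/-- The quotient of `∏ i ∈ s, (1 + p i • z) - exp ((∑ i ∈ s, p i) • z)` by `z`, as given by
integrating the derivative of `poissonPath`. -/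
noncomputable def poissonQuotient (s : Finset ι) (p : ι → ℝ) (z : A) : A :=
  -∫ τ in (0 : ℝ)..1,
    τ • ∑ i ∈ s, p i ^ 2 • (z * poissonPath (s.erase i) p (∑ j ∈ s, p j) z τ)

theorem prod_one_add_smul_sub_exp (s : Finset ι) (p : ι → ℝ) (z : A) :
    ∏ i ∈ s, (1 + p i • z) - NormedSpace.exp ((∑ i ∈ s, p i) • z) = z * poissonQuotient s p z := by
  have hcont (i : ι) := continuous_poissonPath (s.erase i) p (∑ j ∈ s, p j) z
  have hcont' := continuous_poissonPath s p (∑ j ∈ s, p j) z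
  have hint := intervalIntegral.integral_eq_sub_of_hasDerivAt (a := 0) (b := 1)
    (fun τ _ => hasDerivAt_poissonPath s p (∑ i ∈ s, p i) z τ)
    (Continuous.intervalIntegrable (by fun_prop) 0 1)
  rw [poissonPath_zero, poissonPath_one] at hint
  rw [← hint, poissonQuotient, ← intervalIntegral.integral_neg]
  change _ = ContinuousLinearMap.mul ℝ A z _
  rw [← ContinuousLinearMap.intervalIntegral_comp_comm _
    (Continuous.intervalIntegrable (by fun_prop) 0 1)]
  refine intervalIntegral.integral_congr fun τ _ => ?_
  simp only [sub_self, zero_smul, zero_sub, ContinuousLinearMap.mul_apply', mul_neg,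
    mul_smul_comm, Finset.mul_sum, pow_two, mul_assoc]

end Interpolation

section SqrtOneSub

variable {τ : ℝ}

theorem hasDerivAt_sqrt_one_sub (hτ : τ < 1) :
    HasDerivAt (fun τ : ℝ => √(1 - τ)) (-(1 / (2 * √(1 - τ)))) τ := by
  simpa [neg_div] using ((hasDerivAt_id τ).const_sub 1).sqrt (sub_pos.2 hτ).ne'

theorem hasDerivAt_one_div_sqrt_one_sub (hτ : τ < 1) :
    HasDerivAt (fun τ : ℝ => 1 / √(1 - τ)) (1 / (2 * ((1 - τ) * √(1 - τ)))) τ := by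
  have hpos := sub_pos.2 hτ
  have hsqrt := Real.sqrt_pos.2 hpos
  simp only [one_div]
  refine ((hasDerivAt_sqrt_one_sub hτ).inv hsqrt.ne').congr_deriv ?_
  rw [neg_neg, Real.sq_sqrt hpos.le]
  field_simp

theorem intervalIntegrable_one_div_sqrt_one_sub :
    IntervalIntegrable (fun τ : ℝ => 1 / √(1 - τ)) volume 0 1 := by
  have h := (intervalIntegral.intervalIntegrable_rpow' (a := 1) (b := 0) (r := -(1 / 2))
    (by norm_num)).comp_sub_left 1
  simp only [sub_self, sub_zero] at h
  refine h.congr fun τ hτ => ?_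
  rw [Set.uIoc_of_le zero_le_one] at hτ
  simp only [Real.rpow_neg (sub_nonneg.2 hτ.2), Real.sqrt_eq_rpow, one_div]

theorem integral_one_div_sqrt_one_sub : ∫ τ in (0 : ℝ)..1, 1 / √(1 - τ) = 2 := by
  have hderiv (τ : ℝ) (hτ : τ ∈ Set.Ioo (0 : ℝ) 1) :
      HasDerivAt (fun τ : ℝ => -2 * √(1 - τ)) (1 / √(1 - τ)) τ :=
    ((hasDerivAt_sqrt_one_sub hτ.2).const_mul (-2)).congr_deriv (by ring)
  rw [intervalIntegral.integral_eq_sub_of_hasDerivAt_of_le zero_le_one (by fun_prop) hderiv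
    intervalIntegrable_one_div_sqrt_one_sub]
  norm_num

end SqrtOneSub

section PathBounds

variable {A ι : Type*} [NormedCommRing A] [NormedAlgebra ℝ A] [NormOneClass A]
  {s : Finset ι} {p : ι → ℝ} {x : A} {t τ : ℝ}

theorem norm_one_add_smul_sub_one_le (hx : ‖x‖ ≤ 1) {q : ℝ} (hq : q ∈ Set.Icc (0 : ℝ) 1) :
    ‖1 + q • (x - 1)‖ ≤ 1 :=
  calc ‖1 + q • (x - 1)‖ = ‖(1 - q) • (1 : A) + q • x‖ := by congr 1; module
    _ ≤ (1 - q) * ‖(1 : A)‖ + q * ‖x‖ := by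
        refine norm_add_le_of_le (norm_smul_le _ _ |>.trans_eq ?_) (norm_smul_le _ _ |>.trans_eq ?_)
        · rw [Real.norm_of_nonneg (sub_nonneg.2 hq.2)]
        · rw [Real.norm_of_nonneg hq.1]
    _ ≤ (1 - q) * 1 + q * 1 := by rw [norm_one]; gcongr; exact hq.1
    _ = 1 := by ring

variable [CompleteSpace A]

theorem norm_sub_one_pow_mul_poissonPath_le (hx : ‖x‖ ≤ 1) (hp : ∀ i ∈ s, p i ∈ Set.Icc (0 : ℝ) 1)
    (ht : 0 < t) (hτ : τ ∈ Set.Ico (0 : ℝ) 1) {n : ℕ} (hn : n ≠ 0) :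
    ‖(x - 1) ^ n * poissonPath s p t (x - 1) τ‖ ≤ √(n / ((1 - τ) * t)) ^ n := by
  have hprod : ‖∏ i ∈ s, (1 + (τ * p i) • (x - 1))‖ ≤ 1 :=
    (Finset.norm_prod_le s _).trans <| Finset.prod_le_one (fun _ _ => norm_nonneg _) fun i hi =>
      norm_one_add_smul_sub_one_le hx
        ⟨mul_nonneg hτ.1 (hp i hi).1, mul_le_one₀ hτ.2.le (hp i hi).1 (hp i hi).2⟩
  rw [poissonPath, mul_left_comm]
  exact (norm_mul_le_of_le hprod (norm_sub_one_pow_mul_exp_le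
    (mul_pos (sub_pos.2 hτ.2) ht) hx hn)).trans_eq (one_mul _)

theorem norm_sub_one_sq_mul_poissonPath_le (hx : ‖x‖ ≤ 1)
    (hp : ∀ i ∈ s, p i ∈ Set.Icc (0 : ℝ) 1) (ht : 0 < t) (hτ : τ ∈ Set.Ico (0 : ℝ) 1) :
    ‖(x - 1) ^ 2 * poissonPath s p t (x - 1) τ‖ ≤ 2 / t / ((1 - τ) * √(1 - τ)) := by
  have hpos : 0 < 1 - τ := sub_pos.2 hτ.2
  have : 0 < √(1 - τ) := Real.sqrt_pos.2 hpos
  calc ‖(x - 1) ^ 2 * poissonPath s p t (x - 1) τ‖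
      ≤ √((2 : ℕ) / ((1 - τ) * t)) ^ 2 :=
        norm_sub_one_pow_mul_poissonPath_le hx hp ht hτ two_ne_zero
    _ = 2 / t / (1 - τ) := by
        rw [Real.sq_sqrt (by positivity), Nat.cast_two, div_div, mul_comm t]
    _ ≤ 2 / t / ((1 - τ) * √(1 - τ)) := by
        gcongr
        exact mul_le_of_le_one_right hpos.le (Real.sqrt_le_one.2 (sub_le_self 1 hτ.1))

theorem norm_sub_one_cube_mul_poissonPath_le (hx : ‖x‖ ≤ 1)
    (hp : ∀ i ∈ s, p i ∈ Set.Icc (0 : ℝ) 1) (ht : 0 < t) (hτ : τ ∈ Set.Ico (0 : ℝ) 1) :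
    ‖(x - 1) ^ 3 * poissonPath s p t (x - 1) τ‖ ≤ 6 / (t * √t) / ((1 - τ) * √(1 - τ)) := by
  have hpos : 0 < 1 - τ := sub_pos.2 hτ.2
  have : 0 < √(1 - τ) := Real.sqrt_pos.2 hpos
  have hsqrt3 : √3 ≤ 2 := Real.sqrt_le_left two_pos.le |>.2 (by norm_num)
  calc ‖(x - 1) ^ 3 * poissonPath s p t (x - 1) τ‖
      ≤ √((3 : ℕ) / ((1 - τ) * t)) ^ 3 :=
        norm_sub_one_pow_mul_poissonPath_le hx hp ht hτ three_ne_zero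
    _ = 3 * √3 / (t * √t) / ((1 - τ) * √(1 - τ)) := by
        rw [pow_succ, Real.sq_sqrt (by positivity), Nat.cast_ofNat, Real.sqrt_div zero_le_three,
          Real.sqrt_mul hpos.le]
        field_simp
    _ ≤ 6 / (t * √t) / ((1 - τ) * √(1 - τ)) := by
        gcongr
        linarith

theorem norm_sub_one_mul_deriv_poissonPath_le [DecidableEq ι] (hx : ‖x‖ ≤ 1)
    (hp : ∀ i ∈ s, p i ∈ Set.Icc (0 : ℝ) 1) (ht : 0 < t) (hτ : τ ∈ Set.Ico (0 : ℝ) 1) :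
    ‖(x - 1) * ((∑ i ∈ s, p i - t) • ((x - 1) * poissonPath s p t (x - 1) τ) -
        τ • ((x - 1) ^ 2 * ∑ i ∈ s, p i ^ 2 • poissonPath (s.erase i) p t (x - 1) τ))‖ ≤
      (|∑ i ∈ s, p i - t| * (2 / t) + (∑ i ∈ s, p i ^ 2) * (6 / (t * √t))) *
        (1 / ((1 - τ) * √(1 - τ))) := by
  set w := (1 - τ) * √(1 - τ)
  have hpoint : ‖(∑ i ∈ s, p i - t) • ((x - 1) ^ 2 * poissonPath s p t (x - 1) τ)‖ ≤
      |∑ i ∈ s, p i - t| * (2 / t / w) := by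
    rw [norm_smul, Real.norm_eq_abs]
    gcongr
    exact norm_sub_one_sq_mul_poissonPath_le hx hp ht hτ
  have hsum : ‖∑ i ∈ s, p i ^ 2 • ((x - 1) ^ 3 * poissonPath (s.erase i) p t (x - 1) τ)‖ ≤
      ∑ i ∈ s, p i ^ 2 * (6 / (t * √t) / w) := by
    refine norm_sum_le_of_le s fun i _ => ?_
    rw [norm_smul, Real.norm_of_nonneg (sq_nonneg _)]
    gcongr
    exact norm_sub_one_cube_mul_poissonPath_le hx
      (fun j hj => hp j (Finset.mem_of_mem_erase hj)) ht hτ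
  have hτsum : ‖τ • ∑ i ∈ s, p i ^ 2 • ((x - 1) ^ 3 * poissonPath (s.erase i) p t (x - 1) τ)‖ ≤
      ∑ i ∈ s, p i ^ 2 * (6 / (t * √t) / w) := by
    rw [norm_smul, Real.norm_of_nonneg hτ.1]
    exact (mul_le_of_le_one_left (norm_nonneg _) hτ.2.le).trans hsum
  rw [mul_sub]
  simp only [mul_smul_comm, Finset.mul_sum, ← mul_assoc, ← pow_succ', ← pow_two]
  refine (norm_sub_le_of_le hpoint hτsum).trans_eq ?_
  rw [← Finset.sum_mul]
  ring

theorem norm_sub_one_mul_poissonPath_sub_exp_le (hx : ‖x‖ ≤ 1)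
    (hp : ∀ i ∈ s, p i ∈ Set.Icc (0 : ℝ) 1) (ht : 0 < t) (hτ : τ ∈ Set.Ico (0 : ℝ) 1) :
    ‖(x - 1) * poissonPath s p t (x - 1) τ - (x - 1) * NormedSpace.exp (t • (x - 1))‖ ≤
      (|∑ i ∈ s, p i - t| * (4 / t) + (∑ i ∈ s, p i ^ 2) * (12 / (t * √t))) * (1 / √(1 - τ)) := by
  classical
  set K := |∑ i ∈ s, p i - t| * (2 / t) + (∑ i ∈ s, p i ^ 2) * (6 / (t * √t)) with hK
  have hpath (σ : ℝ) := ((hasDerivAt_poissonPath s p t (x - 1) σ).const_mul (x - 1)).sub_const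
    ((x - 1) * NormedSpace.exp (t • (x - 1)))
  have hboundary (σ : ℝ) (hσ : σ < 1) : HasDerivAt (fun σ => 2 * K * (1 / √(1 - σ)))
      (K * (1 / ((1 - σ) * √(1 - σ)))) σ :=
    ((hasDerivAt_one_div_sqrt_one_sub hσ).const_mul (2 * K)).congr_deriv (by field_simp)
  calc ‖(x - 1) * poissonPath s p t (x - 1) τ - (x - 1) * NormedSpace.exp (t • (x - 1))‖
      ≤ 2 * K * (1 / √(1 - τ)) :=
        image_norm_le_of_norm_deriv_right_le_deriv_boundary' (a := 0) (b := τ)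
          (fun σ _ => (hpath σ).continuousAt.continuousWithinAt)
          (fun σ _ => (hpath σ).hasDerivWithinAt)
          (by rw [poissonPath_zero, sub_self, norm_zero]; positivity)
          (fun σ hσ => (hboundary σ (hσ.2.trans_lt hτ.2)).continuousAt.continuousWithinAt)
          (fun σ hσ => (hboundary σ (hσ.2.trans hτ.2)).hasDerivWithinAt)
          (fun σ hσ => norm_sub_one_mul_deriv_poissonPath_le hx hp ht ⟨hσ.1, hσ.2.trans hτ.2⟩)
          ⟨hτ.1, le_rfl⟩
    _ = _ := by
        rw [hK]
        ring

end PathBounds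

section QuotientBounds

variable {A ι : Type*} [NormedCommRing A] [NormedAlgebra ℝ A] [CompleteSpace A] [DecidableEq ι]

theorem poissonQuotient_add_smul_eq_neg_integral (s : Finset ι) (p : ι → ℝ) (z y : A) :
    poissonQuotient s p z + ((∑ i ∈ s, p i ^ 2) / 2) • y = -∫ τ in (0 : ℝ)..1,
      τ • ∑ i ∈ s, p i ^ 2 • (z * poissonPath (s.erase i) p (∑ j ∈ s, p j) z τ - y) := by
  have hcont (i : ι) := continuous_poissonPath (s.erase i) p (∑ j ∈ s, p j) z
  have hy : ((∑ i ∈ s, p i ^ 2) / 2) • y = ∫ τ in (0 : ℝ)..1, τ • ∑ i ∈ s, p i ^ 2 • y := by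
    rw [intervalIntegral.integral_smul_const, integral_id, ← Finset.sum_smul, smul_smul]
    norm_num [div_eq_inv_mul]
  rw [hy, poissonQuotient, neg_add_eq_sub, ← neg_sub, ← intervalIntegral.integral_sub
    (Continuous.intervalIntegrable (by fun_prop) 0 1)
    (Continuous.intervalIntegrable (by fun_prop) 0 1)]
  simp only [smul_sub, Finset.sum_sub_distrib]

variable [NormOneClass A] {s : Finset ι} {p : ι → ℝ} {x : A} {τ : ℝ}

theorem norm_sum_smul_poissonPath_erase_sub_exp_le (hx : ‖x‖ ≤ 1)
    (hp : ∀ i ∈ s, p i ∈ Set.Icc (0 : ℝ) 1) (hsum : 0 < ∑ i ∈ s, p i)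
    (hτ : τ ∈ Set.Ico (0 : ℝ) 1) :
    ‖∑ i ∈ s, p i ^ 2 • ((x - 1) * poissonPath (s.erase i) p (∑ j ∈ s, p j) (x - 1) τ -
        (x - 1) * NormedSpace.exp ((∑ j ∈ s, p j) • (x - 1)))‖ ≤
      ((∑ i ∈ s, p i ^ 3) * (4 / ∑ i ∈ s, p i) +
        (∑ i ∈ s, p i ^ 2) ^ 2 * (12 / ((∑ i ∈ s, p i) * √(∑ i ∈ s, p i)))) *
        (1 / √(1 - τ)) := by
  set t := ∑ j ∈ s, p j with ht
  have hterm (i : ι) (hi : i ∈ s) :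
      ‖p i ^ 2 • ((x - 1) * poissonPath (s.erase i) p t (x - 1) τ -
        (x - 1) * NormedSpace.exp (t • (x - 1)))‖ ≤
      p i ^ 2 * ((p i * (4 / t) + (∑ j ∈ s, p j ^ 2) * (12 / (t * √t))) * (1 / √(1 - τ))) := by
    have hdiff : |∑ j ∈ s.erase i, p j - t| = p i := by
      rw [ht, ← Finset.add_sum_erase s p hi, sub_add_cancel_right, abs_neg,
        abs_of_nonneg (hp i hi).1]
    have hsq : ∑ j ∈ s.erase i, p j ^ 2 ≤ ∑ j ∈ s, p j ^ 2 :=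
      Finset.sum_le_sum_of_subset_of_nonneg (Finset.erase_subset i s) fun j _ _ => sq_nonneg _
    have hpath := norm_sub_one_mul_poissonPath_sub_exp_le (s := s.erase i) hx
      (fun j hj => hp j (Finset.mem_of_mem_erase hj)) hsum hτ
    rw [hdiff] at hpath
    rw [norm_smul, Real.norm_of_nonneg (sq_nonneg _)]
    refine mul_le_mul_of_nonneg_left (hpath.trans ?_) (sq_nonneg _)
    gcongr
  refine (norm_sum_le_of_le s hterm).trans_eq ?_
  calc ∑ i ∈ s, p i ^ 2 * ((p i * (4 / t) + (∑ j ∈ s, p j ^ 2) * (12 / (t * √t))) * (1 / √(1 - τ)))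
      = ∑ i ∈ s, (p i ^ 3 * (4 / t * (1 / √(1 - τ))) +
          p i ^ 2 * ((∑ j ∈ s, p j ^ 2) * (12 / (t * √t)) * (1 / √(1 - τ)))) :=
        Finset.sum_congr rfl fun i _ => by ring
    _ = _ := by
        rw [Finset.sum_add_distrib, ← Finset.sum_mul, ← Finset.sum_mul]
        ring

theorem norm_poissonQuotient_add_le (hx : ‖x‖ ≤ 1)
    (hp : ∀ i ∈ s, p i ∈ Set.Icc (0 : ℝ) 1) (hsum : 0 < ∑ i ∈ s, p i) :
    ‖poissonQuotient s p (x - 1) + ((∑ i ∈ s, p i ^ 2) / 2) •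
        ((x - 1) * NormedSpace.exp ((∑ i ∈ s, p i) • (x - 1)))‖ ≤
      (∑ i ∈ s, p i ^ 3) * (8 / ∑ i ∈ s, p i) +
        (∑ i ∈ s, p i ^ 2) ^ 2 * (24 / ((∑ i ∈ s, p i) * √(∑ i ∈ s, p i))) := by
  set K := (∑ i ∈ s, p i ^ 3) * (4 / ∑ i ∈ s, p i) +
    (∑ i ∈ s, p i ^ 2) ^ 2 * (12 / ((∑ i ∈ s, p i) * √(∑ i ∈ s, p i))) with hK
  have hae : ∀ᵐ τ : ℝ, τ ≠ 1 := compl_mem_ae_iff.2 (measure_singleton 1)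
  rw [poissonQuotient_add_smul_eq_neg_integral, norm_neg]
  calc _ ≤ ∫ τ in (0 : ℝ)..1, K * (1 / √(1 - τ)) := by
        refine intervalIntegral.norm_integral_le_of_norm_le zero_le_one ?_
          (intervalIntegrable_one_div_sqrt_one_sub.const_mul K)
        filter_upwards [hae] with τ hτ1 hτ
        rw [norm_smul, Real.norm_of_nonneg hτ.1.le]
        exact (mul_le_of_le_one_left (norm_nonneg _) hτ.2).trans
          (norm_sum_smul_poissonPath_erase_sub_exp_le hx hp hsum
            ⟨hτ.1.le, lt_of_le_of_ne hτ.2 hτ1⟩)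
    _ = _ := by
        rw [intervalIntegral.integral_const_mul, integral_one_div_sqrt_one_sub, hK]
        ring

end QuotientBounds

/-- The Wiener algebra on the unit disc: power series with absolutely summable coefficients, i.e.
the convolution algebra of `ℓ¹(ℕ)`. -/
def wienerAlgebra (𝕜 : Type*) [NormedField 𝕜] : Subalgebra 𝕜 (PowerSeries 𝕜) where
  carrier := {f | Summable fun k => ‖PowerSeries.coeff k f‖}
  mul_mem' {f g} hf hg := by
    simpa only [PowerSeries.coeff_mul, Set.mem_ofPred_eq] using
      summable_norm_sum_mul_antidiagonal_of_summable_norm hf hg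
  add_mem' {f g} hf hg :=
    (hf.add hg).of_nonneg_of_le (fun _ => norm_nonneg _) fun k => by
      simpa only [map_add] using norm_add_le _ _
  algebraMap_mem' r := summable_of_ne_finset_zero (s := {0}) fun k hk => by
    simp [PowerSeries.coeff_C, Finset.notMem_singleton.1 hk]

namespace wienerAlgebra

variable {𝕜 : Type*} [NormedField 𝕜]

theorem summable_norm_coeff (f : wienerAlgebra 𝕜) :
    Summable fun k => ‖PowerSeries.coeff k f.1‖ := f.2

/-- The coefficient sequence, as an element of `ℓ¹`; the norm of the Wiener algebra is transported
along it. -/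
noncomputable def coeffs : wienerAlgebra 𝕜 ≃ₗ[𝕜] lp (fun _ : ℕ => 𝕜) 1 where
  toFun f := ⟨fun k => PowerSeries.coeff k (f : PowerSeries 𝕜),
    memℓp_gen (by simpa using summable_norm_coeff f)⟩
  map_add' f g := by ext k; exact map_add (PowerSeries.coeff k) f.1 g.1
  map_smul' c f := by ext; simp
  invFun u := ⟨PowerSeries.mk u, by simpa [wienerAlgebra] using (lp.memℓp u).summable (by simp)⟩
  left_inv f := by ext; simp
  right_inv u := by ext; simp

noncomputable instance : NormedAddCommGroup (wienerAlgebra 𝕜) :=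
  NormedAddCommGroup.induced _ _ (coeffs (𝕜 := 𝕜)) coeffs.injective

theorem coeffs_apply (f : wienerAlgebra 𝕜) (k : ℕ) : coeffs f k = PowerSeries.coeff k f.1 := rfl

theorem norm_coeffs (f : wienerAlgebra 𝕜) : ‖coeffs f‖ = ‖f‖ := rfl

theorem norm_eq_tsum (f : wienerAlgebra 𝕜) : ‖f‖ = ∑' k, ‖PowerSeries.coeff k f.1‖ := by
  rw [← norm_coeffs, lp.norm_eq_tsum_rpow (by simp)]
  simp [coeffs_apply]

noncomputable instance : NormedCommRing (wienerAlgebra 𝕜) where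
  __ := (inferInstance : NormedAddCommGroup (wienerAlgebra 𝕜))
  __ := (inferInstance : CommRing (wienerAlgebra 𝕜))
  norm_mul_le f g := by
    have hf : Summable fun k => ‖‖PowerSeries.coeff k f.1‖‖ := by
      simpa only [norm_norm] using summable_norm_coeff f
    have hg : Summable fun k => ‖‖PowerSeries.coeff k g.1‖‖ := by
      simpa only [norm_norm] using summable_norm_coeff g
    rw [norm_eq_tsum f, norm_eq_tsum g, norm_eq_tsum (f * g),
      tsum_mul_tsum_eq_tsum_sum_antidiagonal_of_summable_norm hf hg]
    refine (summable_norm_coeff (f * g)).tsum_le_tsum (fun k => ?_)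
      (summable_norm_sum_mul_antidiagonal_of_summable_norm hf hg).of_norm
    rw [Subalgebra.coe_mul, PowerSeries.coeff_mul]
    exact norm_sum_le_of_le _ fun _ _ => norm_mul_le _ _

noncomputable instance : NormedAlgebra 𝕜 (wienerAlgebra 𝕜) where
  norm_smul_le c f := by rw [← norm_coeffs, map_smul, norm_smul, norm_coeffs]

instance : NormOneClass (wienerAlgebra 𝕜) where
  norm_one := by
    rw [norm_eq_tsum, tsum_eq_single 0 fun k hk => by simp [PowerSeries.coeff_one, hk]]
    simp

theorem isometry_coeffs : Isometry (coeffs (𝕜 := 𝕜)) :=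
  AddMonoidHomClass.isometry_of_norm coeffs norm_coeffs

instance [CompleteSpace 𝕜] : CompleteSpace (wienerAlgebra 𝕜) :=
  (IsometryEquiv.mk coeffs.toEquiv isometry_coeffs).completeSpace

theorem hasSum_coeff {ι : Type*} {u : ι → wienerAlgebra 𝕜} {f : wienerAlgebra 𝕜} (h : HasSum u f)
    (k : ℕ) : HasSum (fun i => PowerSeries.coeff k (u i).1) (PowerSeries.coeff k f.1) :=
  (h.map coeffs isometry_coeffs.continuous).mapL (lp.evalCLM 𝕜 (fun _ : ℕ => 𝕜) 1 k)

/-- The variable of the Wiener algebra, i.e. the right shift of `ℓ¹(ℕ)`. -/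
noncomputable def X : wienerAlgebra 𝕜 :=
  ⟨PowerSeries.X, summable_of_ne_finset_zero (s := {1}) fun k hk => by
    simpa [PowerSeries.coeff_X] using hk⟩

theorem norm_X_le : ‖(X : wienerAlgebra 𝕜)‖ ≤ 1 := by
  rw [norm_eq_tsum, tsum_eq_single 1 fun k hk => by simp [X, PowerSeries.coeff_X, hk]]
  simp [X]

theorem coeff_eq_of_hasSum_smul_X_pow {c : ℕ → 𝕜} {f : wienerAlgebra 𝕜}
    (h : HasSum (fun k => c k • X ^ k) f) (k : ℕ) : PowerSeries.coeff k f.1 = c k := by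
  refine (hasSum_coeff h k).unique ?_
  convert! hasSum_ite_eq k (c k) using 2 with i
  rcases eq_or_ne i k with rfl | hik
  · simp [X]
  · simp [X, PowerSeries.coeff_X_pow, hik, hik.symm]

theorem coeff_exp (t : ℝ) (k : ℕ) :
    PowerSeries.coeff k (NormedSpace.exp (t • ((X : wienerAlgebra ℝ) - 1))).1 = poissonWeight t k :=
  coeff_eq_of_hasSum_smul_X_pow (hasSum_poissonWeight_smul_pow t X) k

theorem norm_X_sub_one_mul_exp {t : ℝ} (ht : 0 < t) :
    ‖(X - 1) * NormedSpace.exp (t • ((X : wienerAlgebra ℝ) - 1))‖ = 2 * poissonWeight t ⌊t⌋₊ := by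
  rw [norm_eq_tsum, ← (hasSum_abs_div_sub_one_mul_poissonWeight ht).tsum_eq]
  exact tsum_congr fun k =>
    congrArg _ (coeff_eq_of_hasSum_smul_X_pow (hasSum_sub_one_mul_exp ht.ne' X) k)

end wienerAlgebra

section Stirling

theorem log_stirlingSeq_le {n : ℕ} (hn : n ≠ 0) :
    Real.log (Stirling.stirlingSeq n) ≤ Real.log √Real.pi + 1 / (12 * n) := by
  obtain ⟨n, rfl⟩ := Nat.exists_eq_succ_of_ne_zero hn
  let corrected (k : ℕ) : ℝ :=
    Real.log (Stirling.stirlingSeq (k + 1)) - 1 / (12 * ((k + 1 : ℕ) : ℝ))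
  have hmono : Monotone corrected := monotone_nat_of_le_succ fun k => by
    have hstep := Stirling.log_stirlingSeq_sdiff_le (k + 1)
    have htelescope : (1 : ℝ) / (12 * (k + 1 : ℕ) * ((k + 1 : ℕ) + 1)) =
        1 / (12 * ((k + 1 : ℕ) : ℝ)) - 1 / (12 * ((k + 1 + 1 : ℕ) : ℝ)) := by
      push_cast
      field_simp
      ring
    dsimp only [corrected]
    linarith
  have hlim : Tendsto corrected atTop (𝓝 (Real.log √Real.pi - 0)) := by
    have hlog := ((Real.continuousAt_log (by positivity)).tendsto.comp
      Stirling.tendsto_stirlingSeq_sqrt_pi).comp (tendsto_add_atTop_nat 1)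
    have hinv := (tendsto_one_div_add_atTop_nhds_zero_nat (𝕜 := ℝ)).const_mul (1 / 12)
    rw [mul_zero] at hinv
    refine hlog.sub (hinv.congr fun k => ?_)
    push_cast
    field_simp
  have hle := hmono.ge_of_tendsto hlim n
  dsimp only [corrected] at hle
  rw [Nat.succ_eq_add_one]
  linarith

theorem log_sqrt_mul_poissonWeight {t : ℝ} (ht : 0 < t) {m : ℕ} (hm : m ≠ 0) :
    Real.log (√(2 * Real.pi * t) * poissonWeight t m) =
      Real.log (t / m) / 2 + (m * Real.log (t / m) - (t - m))
        - (Real.log (Stirling.stirlingSeq m) - Real.log √Real.pi) := by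
  have hm' : (0 : ℝ) < m := by positivity
  rw [Stirling.log_stirlingSeq_formula, poissonWeight, Real.log_mul (by positivity) (by positivity),
    Real.log_div (by positivity) (by positivity), Real.log_mul (by positivity) (by positivity),
    Real.log_exp, Real.log_pow, Real.log_sqrt (by positivity), Real.log_sqrt (by positivity),
    Real.log_mul (by positivity) (by positivity), Real.log_mul (by positivity) (by positivity),
    Real.log_div ht.ne' hm'.ne', Real.log_mul (by positivity) hm'.ne',
    Real.log_div hm'.ne' (by positivity), Real.log_exp]
  ring

theorem mul_log_div_le {m t : ℝ} (hm : 0 < m) (ht : 0 < t) : m * Real.log (t / m) ≤ t - m := by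
  have h := mul_le_mul_of_nonneg_left (Real.log_le_sub_one_of_pos (div_pos ht hm)) hm.le
  rwa [mul_sub, mul_div_cancel₀ _ hm.ne', mul_one] at h

theorem sub_sub_sq_div_le_mul_log_div {m t : ℝ} (hm : 0 < m) (hmt : m ≤ t) :
    t - m - (t - m) ^ 2 / (2 * m) ≤ m * Real.log (t / m) := by
  obtain ⟨x, rfl⟩ : ∃ x, t = m * (1 + x) := ⟨t / m - 1, by field_simp; ring⟩
  have hx : 0 ≤ x := by nlinarith
  rw [mul_div_cancel_left₀ _ hm.ne']
  calc m * (1 + x) - m - (m * (1 + x) - m) ^ 2 / (2 * m) = m * (x - x ^ 2 / 2) := by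
        field_simp
        ring
    _ ≤ m * (2 * x / (x + 2)) := by
        gcongr
        rw [le_div_iff₀ (by linarith)]
        nlinarith [pow_nonneg hx 3]
    _ ≤ m * Real.log (1 + x) := by gcongr; exact Real.le_log_one_add_of_nonneg hx

theorem abs_log_sqrt_mul_poissonWeight_floor_le {t : ℝ} (ht : 1 ≤ t) :
    |Real.log (√(2 * Real.pi * t) * poissonWeight t ⌊t⌋₊)| ≤ 1 / ⌊t⌋₊ := by
  have ht0 : 0 < t := one_pos.trans_le ht
  have hm : 0 < ⌊t⌋₊ := Nat.floor_pos.2 ht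
  rw [log_sqrt_mul_poissonWeight ht0 hm.ne']
  have hmt : (⌊t⌋₊ : ℝ) ≤ t := Nat.floor_le ht0.le
  have htm : t - ⌊t⌋₊ ≤ 1 := by linarith [Nat.lt_floor_add_one t]
  have hstirling := log_stirlingSeq_le hm.ne'
  have hpi : Real.log √Real.pi ≤ Real.log (Stirling.stirlingSeq ⌊t⌋₊) :=
    Real.log_le_log (by positivity) (Stirling.sqrt_pi_le_stirlingSeq hm.ne')
  have hm' : (0 : ℝ) < ⌊t⌋₊ := Nat.cast_pos.2 hm
  generalize (⌊t⌋₊ : ℝ) = m at *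
  have hupper := mul_log_div_le hm' ht0
  have hlower := sub_sub_sq_div_le_mul_log_div hm' hmt
  have hsq : (t - m) ^ 2 / (2 * m) ≤ 1 / (2 * m) := by
    gcongr
    exact pow_le_one₀ (sub_nonneg.2 hmt) htm
  have hlog_nonneg : 0 ≤ Real.log (t / m) := Real.log_nonneg ((one_le_div hm').2 hmt)
  have hlog_le : Real.log (t / m) ≤ 1 / m := by
    rw [le_div_iff₀' hm']
    exact hupper.trans htm
  have htwo : 1 / (2 * m) = 1 / 2 * (1 / m) := by ring
  have htwelve : 1 / (12 * m) = 1 / 12 * (1 / m) := by ring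
  have hinv : 0 < 1 / m := by positivity
  rw [abs_le]
  constructor <;> linarith

theorem abs_poissonWeight_floor_sub_le {t : ℝ} (ht : 0 < t) :
    |poissonWeight t ⌊t⌋₊ - 1 / √(2 * Real.pi * t)| ≤ 4 / t := by
  have hsqrt : 0 < √(2 * Real.pi * t) := by positivity
  have hw : 0 < poissonWeight t ⌊t⌋₊ := by
    unfold poissonWeight
    positivity
  rcases lt_or_ge t 1 with ht1 | ht1
  · have hfloor : poissonWeight t ⌊t⌋₊ ≤ 1 := by
      simpa [Nat.floor_eq_zero.2 ht1, poissonWeight] using ht.le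
    have hinv : 1 / √(2 * Real.pi * t) ≤ 1 / t := by
      gcongr
      exact Real.le_sqrt_of_sq_le (by nlinarith [Real.pi_gt_three])
    have hone : 1 ≤ 1 / t := (one_le_div ht).2 ht1.le
    have hfour : 4 / t = 4 * (1 / t) := by ring
    have hinv_pos := one_div_pos.2 hsqrt
    rw [abs_le]
    constructor <;> linarith
  have hm : (1 : ℝ) ≤ ⌊t⌋₊ := by exact_mod_cast Nat.floor_pos.2 ht1
  have hlog := abs_log_sqrt_mul_poissonWeight_floor_le ht1
  have hexp := Real.abs_exp_sub_one_le (hlog.trans ((div_le_one (one_pos.trans_le hm)).2 hm))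
  rw [Real.exp_log (by positivity)] at hexp
  have hone : 1 ≤ √(2 * Real.pi * t) := Real.one_le_sqrt.2 (by nlinarith [Real.pi_gt_three])
  have hfloor : 1 / (⌊t⌋₊ : ℝ) ≤ 2 / t := by
    rw [div_le_div_iff₀ (by linarith) ht]
    linarith [Nat.lt_floor_add_one t]
  calc |poissonWeight t ⌊t⌋₊ - 1 / √(2 * Real.pi * t)|
      = |√(2 * Real.pi * t) * poissonWeight t ⌊t⌋₊ - 1| / √(2 * Real.pi * t) := by
        rw [eq_div_iff hsqrt.ne', ← abs_of_pos hsqrt, ← abs_mul, abs_of_pos hsqrt]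
        field_simp
    _ ≤ |√(2 * Real.pi * t) * poissonWeight t ⌊t⌋₊ - 1| := div_le_self (abs_nonneg _) hone
    _ ≤ 2 * (2 / t) := by linarith
    _ = 4 / t := by ring

end Stirling

section GeneratingFunction

theorem sum_range_coeff_X_sub_one_mul {R : Type*} [Ring R] (f : PowerSeries R) (n : ℕ) :
    ∑ k ∈ Finset.range (n + 1), PowerSeries.coeff k ((PowerSeries.X - 1) * f) =
      -PowerSeries.coeff n f := by
  induction n with
  | zero => simp [sub_mul]
  | succ n ih => rw [Finset.sum_range_succ, ih, sub_mul, one_mul, map_sub,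
      PowerSeries.coeff_succ_X_mul, ← sub_eq_neg_add]; abel

/-- The probability generating function of a distribution on `ℕ`, as a formal power series. -/
noncomputable def pgf (μ : Measure ℕ) : PowerSeries ℝ :=
  PowerSeries.mk fun k => μ.real {k}

theorem coeff_pgf (μ : Measure ℕ) (k : ℕ) : PowerSeries.coeff k (pgf μ) = μ.real {k} :=
  PowerSeries.coeff_mk k _

theorem pgf_dirac_zero : pgf (Measure.dirac 0) = 1 := by
  ext k
  rcases eq_or_ne k 0 with rfl | hk
  · simp [pgf, Measure.real]
  · simp [pgf, Measure.real, PowerSeries.coeff_one, hk, hk.symm]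

theorem pgf_bernoulliMeasure (q : unitInterval) :
    pgf (bernoulliMeasure 1 0 q) = 1 + (q : ℝ) • (PowerSeries.X - 1) := by
  ext k
  rcases k with _ | _ | k
  · simp [pgf, bernoulliMeasure_real_apply, sub_eq_add_neg]
  · simp [pgf, bernoulliMeasure_real_apply, PowerSeries.coeff_one]
  · simp [pgf, bernoulliMeasure_real_apply, PowerSeries.coeff_one, PowerSeries.coeff_X]

theorem coeff_pgf_poissonMeasure (r : NNReal) (k : ℕ) :
    PowerSeries.coeff k (pgf (poissonMeasure r)) = poissonWeight r k := by
  rw [coeff_pgf, poissonMeasure_real_singleton, poissonWeight]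

theorem pgf_conv (μ ν : Measure ℕ) [IsFiniteMeasure μ] [IsFiniteMeasure ν] :
    pgf (μ ∗ ν) = pgf μ * pgf ν := by
  ext k
  have hpre : (fun x : ℕ × ℕ => x.1 + x.2) ⁻¹' {k} = ↑(Finset.HasAntidiagonal.antidiagonal k) := by
    ext x
    simp
  rw [PowerSeries.coeff_mul, coeff_pgf, Measure.conv,
    map_measureReal_apply (by fun_prop) .of_discrete, hpre, ← sum_measureReal_singleton]
  refine Finset.sum_congr rfl fun x _ => ?_
  rw [coeff_pgf, coeff_pgf, ← measureReal_prod_prod,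
    Set.singleton_prod_singleton]

variable {Ω ι : Type*} [MeasurableSpace Ω] {P : Measure Ω}

theorem pgf_map_sum_eq_prod {ξ : ι → Ω → ℕ} (hindep : iIndepFun ξ P)
    (hmeas : ∀ i, AEMeasurable (ξ i) P) (s : Finset ι) :
    pgf (P.map fun ω => ∑ i ∈ s, ξ i ω) = ∏ i ∈ s, pgf (P.map (ξ i)) := by
  classical
  have := hindep.isProbabilityMeasure
  induction s using Finset.induction_on with
  | empty => simp [Measure.map_const, pgf_dirac_zero]
  | insert i s hi ih =>
    have hsum : (fun ω => ∑ j ∈ insert i s, ξ j ω) = ξ i + ∑ j ∈ s, ξ j := by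
      ext ω
      simp [Finset.sum_insert hi]
    have hconv := (hindep.indepFun_finsetSum_of_notMem₀ hmeas hi).symm.map_add_eq_map_conv_map₀
      (hmeas i) (by fun_prop)
    rw [hsum, hconv, pgf_conv, Finset.prod_insert hi, ← ih]
    congr 3
    ext
    simp

end GeneratingFunction

section PoissonError

variable {n : ℕ} (p : Fin n → unitInterval)

theorem lam_nonneg : 0 ≤ lam p :=
  Finset.sum_nonneg fun i _ => (p i).2.1

theorem lamTwo_nonneg : 0 ≤ lamTwo p :=
  Finset.sum_nonneg fun _ _ => sq_nonneg _

theorem le_maxProb (i : Fin n) : (p i : ℝ) ≤ maxProb p :=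
  le_ciSup (f := fun i => (p i : ℝ)) (Set.finite_range _).bddAbove i

theorem lamTwo_le_maxProb_mul_lam : lamTwo p ≤ maxProb p * lam p := by
  rw [lamTwo, lam, Finset.mul_sum]
  exact Finset.sum_le_sum fun i _ => by
    rw [pow_two]
    exact mul_le_mul_of_nonneg_right (le_maxProb p i) (p i).2.1

theorem sum_cube_le_lamTwo : ∑ i, (p i : ℝ) ^ 3 ≤ lamTwo p :=
  Finset.sum_le_sum fun i _ => pow_le_pow_of_le_one (p i).2.1 (p i).2.2 (by norm_num)

variable {p}

theorem lamTwo_pos (h : 0 < lam p) : 0 < lamTwo p := by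
  obtain ⟨i, hi, hpi⟩ := Finset.exists_ne_zero_of_sum_ne_zero h.ne'
  exact Finset.sum_pos' (fun _ _ => sq_nonneg _) ⟨i, hi, sq_pos_of_ne_zero hpi⟩

variable {Ω : Type*} [MeasurableSpace Ω] {P : Measure Ω} {ξ : Fin n → Ω → ℕ}

theorem IsIndepBernoulli.pgf_map_sum (h : IsIndepBernoulli P p ξ) :
    pgf (P.map fun ω => ∑ i, ξ i ω) = ∏ i, (1 + (p i : ℝ) • (PowerSeries.X - 1)) := by
  rw [pgf_map_sum_eq_prod h.indep fun i => (h.law i).aemeasurable]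
  exact Finset.prod_congr rfl fun i _ => by rw [(h.law i).map_eq, pgf_bernoulliMeasure]

variable [IsProbabilityMeasure P]

theorem poissonError_singleton (h : IsIndepBernoulli P p ξ) (k : ℕ) :
    poissonError P p ξ {k} = PowerSeries.coeff k
      ((PowerSeries.X - 1) * (poissonQuotient Finset.univ (fun i => (p i : ℝ))
        ((wienerAlgebra.X : wienerAlgebra ℝ) - 1)).1) := by
  have hfactor := congrArg (fun f : wienerAlgebra ℝ => PowerSeries.coeff k f.1)
    (prod_one_add_smul_sub_exp Finset.univ (fun i => (p i : ℝ))
      ((wienerAlgebra.X : wienerAlgebra ℝ) - 1))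
  calc poissonError P p ξ {k}
      = PowerSeries.coeff k (∏ i, (1 + (p i : ℝ) • (PowerSeries.X - 1)))
          - poissonWeight (lam p) k := by
        rw [poissonError, sub_apply, Measure.toSignedMeasure_apply_measurable .of_discrete,
          Measure.toSignedMeasure_apply_measurable .of_discrete, ← coeff_pgf, ← coeff_pgf,
          h.pgf_map_sum, coeff_pgf_poissonMeasure, Real.coe_toNNReal _ (lam_nonneg p)]
    _ = _ := by
        rw [← wienerAlgebra.coeff_exp]
        simpa [wienerAlgebra.X, lam] using hfactor

theorem signedCDF_poissonError (h : IsIndepBernoulli P p ξ) (j : ℕ) :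
    signedCDF (poissonError P p ξ) j = -PowerSeries.coeff j
      (poissonQuotient Finset.univ (fun i => (p i : ℝ))
        ((wienerAlgebra.X : wienerAlgebra ℝ) - 1)).1 := by
  rw [signedCDF, ← sum_range_coeff_X_sub_one_mul]
  exact Finset.sum_congr rfl fun k _ => poissonError_singleton h k

theorem finiteWassersteinNorm_poissonError (h : IsIndepBernoulli P p ξ) :
    FiniteWassersteinNorm (poissonError P p ξ) := by
  simp only [FiniteWassersteinNorm, signedCDF_poissonError h, abs_neg]
  exact wienerAlgebra.summable_norm_coeff (𝕜 := ℝ) _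

theorem wassersteinNorm_poissonError (h : IsIndepBernoulli P p ξ) :
    wassersteinNorm (poissonError P p ξ) = ‖poissonQuotient Finset.univ (fun i => (p i : ℝ))
      ((wienerAlgebra.X : wienerAlgebra ℝ) - 1)‖ := by
  simp only [wassersteinNorm, wienerAlgebra.norm_eq_tsum (𝕜 := ℝ), signedCDF_poissonError h,
    abs_neg, Real.norm_eq_abs]

theorem abs_wassersteinNorm_poissonError_sub_poissonWeight_le (h : IsIndepBernoulli P p ξ)
    (hlam : 0 < lam p) :
    |wassersteinNorm (poissonError P p ξ) - lamTwo p * poissonWeight (lam p) ⌊lam p⌋₊| ≤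
      (∑ i, (p i : ℝ) ^ 3) * (8 / lam p) + lamTwo p ^ 2 * (24 / (lam p * √(lam p))) := by
  set z := (wienerAlgebra.X : wienerAlgebra ℝ) - 1
  have hmain : ‖-((lamTwo p / 2) • (z * NormedSpace.exp (lam p • z)))‖ =
      lamTwo p * poissonWeight (lam p) ⌊lam p⌋₊ := by
    rw [norm_neg, norm_smul, wienerAlgebra.norm_X_sub_one_mul_exp hlam,
      Real.norm_of_nonneg (div_nonneg (lamTwo_nonneg p) zero_le_two)]
    ring
  rw [wassersteinNorm_poissonError h, ← hmain]
  refine (abs_norm_sub_norm_le _ _).trans ?_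
  rw [sub_neg_eq_add]
  exact norm_poissonQuotient_add_le wienerAlgebra.norm_X_le (fun i _ => (p i).2) hlam

theorem abs_wassersteinNorm_poissonError_sub_le (h : IsIndepBernoulli P p ξ) (hlam : 0 < lam p) :
    |wassersteinNorm (poissonError P p ξ) - lamTwo p / √(2 * Real.pi * lam p)| ≤
      24 * lamTwo p / √(lam p) * (maxProb p + 1 / √(lam p)) := by
  have hlamTwo := lamTwo_nonneg p
  have hstirling : |lamTwo p * poissonWeight (lam p) ⌊lam p⌋₊ -
      lamTwo p / √(2 * Real.pi * lam p)| ≤ lamTwo p * (4 / lam p) := by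
    rw [← mul_one_div (lamTwo p), ← mul_sub, abs_mul, abs_of_nonneg hlamTwo]
    exact mul_le_mul_of_nonneg_left (abs_poissonWeight_floor_sub_le hlam) hlamTwo
  calc |wassersteinNorm (poissonError P p ξ) - lamTwo p / √(2 * Real.pi * lam p)|
      ≤ (∑ i, (p i : ℝ) ^ 3) * (8 / lam p) + lamTwo p ^ 2 * (24 / (lam p * √(lam p)))
          + lamTwo p * (4 / lam p) := (abs_sub_le _ _ _).trans
        (add_le_add (abs_wassersteinNorm_poissonError_sub_poissonWeight_le h hlam) hstirling)
    _ ≤ lamTwo p * (8 / lam p) +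
          lamTwo p * (maxProb p * lam p) * (24 / (lam p * √(lam p)))
          + lamTwo p * (4 / lam p) := by
        rw [pow_two]
        gcongr
        exacts [sum_cube_le_lamTwo p, lamTwo_le_maxProb_mul_lam p]
    _ = 24 * lamTwo p / √(lam p) * maxProb p + 12 * lamTwo p / lam p := by
        field_simp
        ring
    _ ≤ 24 * lamTwo p / √(lam p) * maxProb p + 24 * lamTwo p / lam p := by
        gcongr
        norm_num
    _ = 24 * lamTwo p / √(lam p) * (maxProb p + 1 / √(lam p)) := by
        rw [mul_add, div_mul_div_comm, Real.mul_self_sqrt hlam.le, mul_one]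

theorem abs_sqrt_div_mul_wassersteinNorm_poissonError_sub_le (h : IsIndepBernoulli P p ξ)
    (hlam : 0 < lam p) :
    |√(lam p) / lamTwo p * wassersteinNorm (poissonError P p ξ) - 1 / √(2 * Real.pi)| ≤
      24 * (maxProb p + 1 / √(lam p)) := by
  have hlamTwo := lamTwo_pos hlam
  have hsqrt := Real.sqrt_pos.2 hlam
  have hscale : √(lam p) / lamTwo p * (lamTwo p / √(2 * Real.pi * lam p)) = 1 / √(2 * Real.pi) := by
    rw [Real.sqrt_mul (by positivity) (lam p)]
    field_simp
  rw [← hscale, ← mul_sub, abs_mul, abs_of_pos (div_pos hsqrt hlamTwo)]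
  calc _ ≤ √(lam p) / lamTwo p *
        (24 * lamTwo p / √(lam p) * (maxProb p + 1 / √(lam p))) := by
        gcongr
        exact abs_wassersteinNorm_poissonError_sub_le h hlam
    _ = 24 * (maxProb p + 1 / √(lam p)) := by field_simp

end PoissonError

theorem tendsto_sqrt_div_mul_wassersteinNorm_poissonError {α : Type*} {l : Filter α}
    {Ω : α → Type*} [∀ a, MeasurableSpace (Ω a)] {P : ∀ a, Measure (Ω a)}
    [∀ a, IsProbabilityMeasure (P a)] {N : α → ℕ} {p : ∀ a, Fin (N a) → unitInterval}
    {ξ : ∀ a, Fin (N a) → Ω a → ℕ} (h : ∀ a, IsIndepBernoulli (P a) (p a) (ξ a))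
    (hmax : Tendsto (fun a => maxProb (p a)) l (𝓝 0))
    (hlam : Tendsto (fun a => lam (p a)) l atTop) :
    Tendsto (fun a => √(lam (p a)) / lamTwo (p a)
      * wassersteinNorm (poissonError (P a) (p a) (ξ a))) l (𝓝 (1 / √(2 * Real.pi))) := by
  have hinv : Tendsto (fun a => 1 / √(lam (p a))) l (𝓝 0) :=
    tendsto_const_nhds.div_atTop (Real.tendsto_sqrt_atTop.comp hlam)
  have hbound : Tendsto (fun a => 24 * (maxProb (p a) + 1 / √(lam (p a)))) l (𝓝 0) := by
    simpa only [add_zero, mul_zero] using (hmax.add hinv).const_mul 24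
  rw [tendsto_iff_dist_tendsto_zero]
  refine squeeze_zero' (.of_forall fun _ => dist_nonneg) ?_ hbound
  filter_upwards [hlam.eventually_gt_atTop 0] with a ha
  exact abs_sqrt_div_mul_wassersteinNorm_poissonError_sub_le (h a) ha

theorem one_div_sqrt_two_pi_le : 1 / √(2 * Real.pi) ≤ 0.399 := by
  rw [one_div_le (by positivity) (by norm_num)]
  refine Real.le_sqrt_of_sq_le ?_
  linarith [Real.pi_gt_d4, show (1 / 0.399 : ℝ) ^ 2 ≤ 2 * 3.1415 by norm_num]

theorem mainTheorem4_general :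
    (∀ {Ω : Type*} [MeasurableSpace Ω] (P : Measure Ω) [IsProbabilityMeasure P]
        (n : ℕ) (p : Fin n → unitInterval) (ξ : Fin n → Ω → ℕ),
        IsIndepBernoulli P p ξ → 0 < lam p →
          FiniteWassersteinNorm (poissonError P p ξ) ∧
          |wassersteinNorm (poissonError P p ξ) - lamTwo p / √(2 * Real.pi * lam p)|
            ≤ 24 * lamTwo p / √(lam p) * (maxProb p + 1 / √(lam p))) ∧
    (∀ {α : Type*} {l : Filter α} {Ω : α → Type*} [∀ a, MeasurableSpace (Ω a)]
        (P : ∀ a, Measure (Ω a)) [∀ a, IsProbabilityMeasure (P a)] (N : α → ℕ)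
        (p : ∀ a, Fin (N a) → unitInterval) (ξ : ∀ a, Fin (N a) → Ω a → ℕ),
        (∀ a, IsIndepBernoulli (P a) (p a) (ξ a)) →
        Tendsto (fun a => maxProb (p a)) l (𝓝 0) →
        Tendsto (fun a => lam (p a)) l atTop →
          (∀ a, FiniteWassersteinNorm (poissonError (P a) (p a) (ξ a))) ∧
          Tendsto (fun a => √(lam (p a)) / lamTwo (p a)
              * wassersteinNorm (poissonError (P a) (p a) (ξ a)))
            l (𝓝 (1 / √(2 * Real.pi)))) ∧
    1 / √(2 * Real.pi) ≤ 0.399 :=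
  ⟨fun _ _ _ _ _ h hlam =>
      ⟨finiteWassersteinNorm_poissonError h, abs_wassersteinNorm_poissonError_sub_le h hlam⟩,
    fun _ _ _ _ _ h hmax hlam => ⟨fun a => finiteWassersteinNorm_poissonError (h a),
      tendsto_sqrt_div_mul_wassersteinNorm_poissonError h hmax hlam⟩,
    one_div_sqrt_two_pi_le⟩

theorem mainTheorem4 :
    (∃ C : ℝ, 0 < C ∧
      ∀ {Ω : Type*} [MeasurableSpace Ω] (P : Measure Ω) [IsProbabilityMeasure P]
        (n : ℕ) (p : Fin n → unitInterval) (ξ : Fin n → Ω → ℕ),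
        IsIndepBernoulli P p ξ → maxProb p ≤ 1 / 20 → 1 ≤ lam p →
          FiniteWassersteinNorm (poissonError P p ξ) ∧
          |wassersteinNorm (poissonError P p ξ) - lamTwo p / √(2 * Real.pi * lam p)|
            ≤ C * lamTwo p / √(lam p) * (maxProb p + 1 / √(lam p))) ∧
    (∀ {Ω : ℕ → Type*} [∀ n, MeasurableSpace (Ω n)] (P : ∀ n, Measure (Ω n))
        [∀ n, IsProbabilityMeasure (P n)] (N : ℕ → ℕ) (p : ∀ n, Fin (N n) → unitInterval)
        (ξ : ∀ n, Fin (N n) → Ω n → ℕ),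
        (∀ n, IsIndepBernoulli (P n) (p n) (ξ n)) →
        Tendsto (fun n => maxProb (p n)) atTop (𝓝 0) →
        Tendsto (fun n => lam (p n)) atTop atTop →
          (∀ n, FiniteWassersteinNorm (poissonError (P n) (p n) (ξ n))) ∧
          Tendsto (fun n => √(lam (p n)) / lamTwo (p n)
              * wassersteinNorm (poissonError (P n) (p n) (ξ n)))
            atTop (𝓝 (1 / √(2 * Real.pi)))) ∧
    1 / √(2 * Real.pi) ≤ 0.399 := by
  obtain ⟨hbound, hlimit, hpi⟩ := mainTheorem4_general
  exact ⟨⟨24, by norm_num, fun P _ n p ξ h _ hlam => hbound P n p ξ h (one_pos.trans_le hlam)⟩,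
    hlimit, hpi⟩
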